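/- Let $M$ be a connected smooth $n$-dimensional manifold with a smooth (pseudo-)Riemannian metric $g$ of arbitrary signature, and let $A_1,\dots,A_n$ be smooth complex-valued 1-forms on $M$, linearly independent at every point, that factorize the metric: $g=\sum_{I=1}^n A_I\otimes A_I$, i.e. $g_{ab}=\sum_I A_{Ia}A_{Ib}$. Suppose that all the $A_I$ are closed, $dA_I=0$, but that they are not all exact, i.e. for at least one $I$ there is no smooth $\varphi:M\to\mathbb{C}$ with $A_I=d\varphi$. Then $M$ is not simply connected, it is non-curved, $R_{abcd}=0$, and: 1. the metric is not globally reducible to a Cartesian-like one: there are no smooth functions $\varphi_1,\dots,\varphi_n:M\to\mathbb{R}$ and signs $\varepsilon_a\in\{1,-1\}$ with $ds^2=\sum_{a=1}^n\varepsilon_a\,(d\varphi_a)^2$ on $M$; 2. the Levi-Civita connection is non-null in any global coordinates: there is no system of global coordinate functions on $M$ in which all the Christoffel symbols $\Gamma^c{}_{ab}$ vanish identically; 3. the geodesics are not straight lines in any global coordinates: there is no system of global coordinate functions $y$ on $M$ in which every geodesic, with affine parameter $s$, is a straight line $y=q+s\,v$ with $q,v\in\mathbb{R}^n$. Here a system of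 global coordinate functions is a map $y:M\to\mathbb{R}^n$ that restricts to a smooth chart on a neighbourhood of every point of $M$ (it need not be injective). -/

import Mathlib

open scoped Manifold ContDiff BigOperators

noncomputable section

namespace Takagi

/-- The model space of an `n`-dimensional manifold. -/
abbrev Model (n : ℕ) : Type := EuclideanSpace ℝ (Fin n)

variable {n : ℕ} {M : Type*} [TopologicalSpace M] [ChartedSpace (Model n) M]

/-- `e` is a smooth coordinate chart of `M` (a member of the maximal smooth atlas). -/
def IsChart (e : OpenPartialHomeomorph M (Model n)) : Prop :=
  e ∈ IsManifold.maximalAtlas (𝓡 n) ∞ M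

/-- The `a`-th vector of the standard basis of `ℝⁿ`. -/
def stdVec (n : ℕ) (a : Fin n) : Model n := EuclideanSpace.single a (1 : ℝ)

/-- The ordinary partial derivative `∂_a f` of a function of the coordinates. -/
def partialDeriv {F : Type*} [NormedAddCommGroup F] [NormedSpace ℝ F]
    (a : Fin n) (f : Model n → F) (x : Model n) : F :=
  fderiv ℝ f x (stdVec n a)

/-- The coordinate vector field `∂_a` of the chart `e`, at the point with coordinates `x`. -/
def coordVec (e : OpenPartialHomeomorph M (Model n)) (x : Model n) (a : Fin n) :
    TangentSpace (𝓡 n) (e.symm x) :=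
  mfderiv (𝓡 n) (𝓡 n) e.symm x (stdVec n a)

/-! ### Complex 1-forms -/

variable (n M) in
/-- Complex-valued 1-forms on `M` (smoothness is a separate predicate). -/
abbrev OneForm : Type _ := ∀ p : M, TangentSpace (𝓡 n) p →L[ℝ] ℂ

/-- The component `A_a` of a 1-form in a chart. -/
def OneForm.comp (A : OneForm n M) (e : OpenPartialHomeomorph M (Model n)) (a : Fin n)
    (x : Model n) : ℂ :=
  A (e.symm x) (coordVec e x a)

/-- A 1-form is smooth if its components are smooth in every chart. -/
def OneForm.IsSmooth (A : OneForm n M) : Prop :=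
  ∀ e : OpenPartialHomeomorph M (Model n), IsChart e →
    ∀ a, ContDiffOn ℝ ∞ (A.comp e a) e.target

/-- The components `F_{ab} = ∂_a A_b - ∂_b A_a` of the exterior derivative `F = dA`. -/
def OneForm.extDerivComp (A : OneForm n M) (e : OpenPartialHomeomorph M (Model n))
    (a b : Fin n) (x : Model n) : ℂ :=
  partialDeriv a (A.comp e b) x - partialDeriv b (A.comp e a) x

/-- `dA = 0`. -/
def OneForm.IsClosed (A : OneForm n M) : Prop :=
  ∀ e : OpenPartialHomeomorph M (Model n), IsChart e →
    ∀ x ∈ e.target, ∀ a b, A.extDerivComp e a b x = 0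

/-- `A = dφ` for a globally defined smooth function `φ`. -/
def OneForm.IsExact (A : OneForm n M) : Prop :=
  ∃ φ : M → ℂ, ContMDiff (𝓡 n) 𝓘(ℝ, ℂ) ∞ φ ∧
    ∀ (p : M) (v : TangentSpace (𝓡 n) p), A p v = mfderiv (𝓡 n) 𝓘(ℝ, ℂ) φ p v

/-! ### Metrics -/

variable (n M) in
/-- A smooth pseudo-Riemannian metric on `M`, of arbitrary signature. -/
structure Metric where
  /-- the bilinear form on each tangent space -/
  val : ∀ p : M, TangentSpace (𝓡 n) p →L[ℝ] TangentSpace (𝓡 n) p →L[ℝ] ℝ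
  symm : ∀ (p : M) (v w : TangentSpace (𝓡 n) p), val p v w = val p w v
  nondegenerate : ∀ (p : M) (v : TangentSpace (𝓡 n) p), (∀ w, val p v w = 0) → v = 0
  smooth : ∀ e : OpenPartialHomeomorph M (Model n), IsChart e → ∀ a b : Fin n,
    ContDiffOn ℝ ∞ (fun x => val (e.symm x) (coordVec e x a) (coordVec e x b)) e.target

namespace Metric

variable (g : Metric n M)

/-- The components `g_{ab}` of the metric in a chart. -/
def comp (e : OpenPartialHomeomorph M (Model n)) (a b : Fin n) (x : Model n) : ℝ :=
  g.val (e.symm x) (coordVec e x a) (coordVec e x b)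

/-- The components `g^{ab}` of the inverse metric in a chart. -/
def invComp (e : OpenPartialHomeomorph M (Model n)) (a b : Fin n) (x : Model n) : ℝ :=
  (Matrix.of fun i j => g.comp e i j x)⁻¹ a b

/-- The Christoffel symbols `Γ^c_{ab}` of the Levi-Civita connection in a chart. -/
def christoffel (e : OpenPartialHomeomorph M (Model n)) (c a b : Fin n) (x : Model n) : ℝ :=
  ∑ d, g.invComp e c d x * ((1 / 2 : ℝ) *
    (partialDeriv a (g.comp e d b) x + partialDeriv b (g.comp e d a) x
      - partialDeriv d (g.comp e a b) x))

/-- The curvature components `R^a_{bcd}` in a chart. -/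
def curvatureUp (e : OpenPartialHomeomorph M (Model n)) (a b c d : Fin n) (x : Model n) : ℝ :=
  partialDeriv c (g.christoffel e a b d) x - partialDeriv d (g.christoffel e a b c) x
    + ∑ k, g.christoffel e a k c x * g.christoffel e k b d x
    - ∑ k, g.christoffel e a k d x * g.christoffel e k b c x

/-- The curvature components `R_{abcd}` in a chart. -/
def curvature (e : OpenPartialHomeomorph M (Model n)) (a b c d : Fin n) (x : Model n) : ℝ :=
  ∑ k, g.comp e a k x * g.curvatureUp e k b c d x

/-- `R_{abcd} = 0` everywhere. -/
def IsNonCurved : Prop :=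
  ∀ e : OpenPartialHomeomorph M (Model n), IsChart e →
    ∀ x ∈ e.target, ∀ a b c d, g.curvature e a b c d x = 0

/-- `γ` is a geodesic, with affine parameter in the open interval `(s₀, s₁)`: in every chart,
`d²x^c/ds² + Γ^c_{ab} (dx^a/ds) (dx^b/ds) = 0`. -/
def IsGeodesicOn (γ : ℝ → M) (s₀ s₁ : ℝ) : Prop :=
  ContMDiffOn 𝓘(ℝ, ℝ) (𝓡 n) ∞ γ (Set.Ioo s₀ s₁) ∧
  ∀ e : OpenPartialHomeomorph M (Model n), IsChart e →
    ∀ s ∈ Set.Ioo s₀ s₁, γ s ∈ e.source → ∀ c : Fin n,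
      deriv (deriv fun t => e (γ t) c) s
        + ∑ a, ∑ b, g.christoffel e c a b (e (γ s))
            * deriv (fun t => e (γ t) a) s * deriv (fun t => e (γ t) b) s = 0

/-- `A_1, …, A_n` is a Takagi factorization of `g`: smooth, pointwise linearly independent
complex 1-forms with `g_{ab} = ∑ I, A_{Ia} A_{Ib}`. -/
structure IsTakagiFactorization (A : Fin n → OneForm n M) : Prop where
  smooth : ∀ I, (A I).IsSmooth
  linearIndependent : ∀ p : M, LinearIndependent ℂ fun I => A I p
  factor : ∀ (p : M) (v w : TangentSpace (𝓡 n) p),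
    (g.val p v w : ℂ) = ∑ I, A I p v * A I p w

/-- The metric is globally reducible to a Cartesian-like one: there are functions
`φ_1, …, φ_n` on all of `M` and signs `ε_a = ±1` with `ds² = ∑ a, ε_a (dφ_a)²`. -/
def IsGloballyCartesian : Prop :=
  ∃ (ε : Fin n → ℝ) (φ : Fin n → M → ℝ),
    (∀ a, ε a = 1 ∨ ε a = -1) ∧
    (∀ a, ContMDiff (𝓡 n) 𝓘(ℝ, ℝ) ∞ (φ a)) ∧
    ∀ (p : M) (v w : TangentSpace (𝓡 n) p),
      g.val p v w = ∑ a, ε a * (show ℝ from mfderiv (𝓡 n) 𝓘(ℝ, ℝ) (φ a) p v)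
        * (show ℝ from mfderiv (𝓡 n) 𝓘(ℝ, ℝ) (φ a) p w)

end Metric

/-! ### Global coordinates -/

/-- `y : M → ℝⁿ` is a system of `n` globally defined coordinate functions: near every point it
restricts to a chart. Injectivity on all of `M` is not required, so every global chart is
included. -/
def IsGlobalCoordinates (y : M → Model n) : Prop :=
  ∀ p : M, ∃ e : OpenPartialHomeomorph M (Model n),
    IsChart e ∧ p ∈ e.source ∧ Set.EqOn y e e.source

/-- All the Christoffel symbols vanish identically in the global coordinates `y`. -/
def Metric.ConnectionNullIn (g : Metric n M) (y : M → Model n) : Prop :=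
  ∀ e : OpenPartialHomeomorph M (Model n), IsChart e → Set.EqOn y e e.source →
    ∀ x ∈ e.target, ∀ c a b, g.christoffel e c a b x = 0

/-- Every geodesic is a straight line `y = q + s v` in the global coordinates `y`. -/
def Metric.GeodesicsStraightIn (g : Metric n M) (y : M → Model n) : Prop :=
  ∀ (s₀ s₁ : ℝ) (γ : ℝ → M), s₀ < s₁ → g.IsGeodesicOn γ s₀ s₁ →
    ∃ q v : Model n, ∀ s ∈ Set.Ioo s₀ s₁, y (γ s) = q + s • v

end Takagi

end

/-!
For a factorization by closed forms the Koszul formula reads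
`g(∇_{∂_a} ∂_b, ∂_d) = ∑ I, A_{Id} ∂_a A_{Ib}`, and nondegeneracy turns this into
`∂_a A_{Ib} = Γ^c_{ab} A_{Ic}`: the forms are parallel. The Ricci identity then makes the curvature
vanish.

On a connected manifold a parallel form is determined by its value at one point. Functions that make
the metric Cartesian, or coordinates that make the connection null, provide a parallel frame of
exact forms, of which every `A_I` is then a combination with constant coefficients, hence exact. If
all geodesics are straight lines in `y`, then `Γ(w, w) = 0` for every initial velocity `w`, so
`Γ = 0` by polarization. Finally, local primitives of a closed form are the sections of a covering
space, which has a global section over a simply connected manifold.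
-/

noncomputable section

namespace Takagi

/-! ### Maps on the model space -/

section Model

variable {n : ℕ} {E F : Type*} [NormedAddCommGroup E] [NormedSpace ℝ E] [NormedAddCommGroup F]
  [NormedSpace ℝ F]

theorem sum_smul_stdVec (v : Model n) : ∑ a, v a • stdVec n a = v := by
  ext i
  simp [stdVec, Pi.single_apply]

theorem map_eq_sum_stdVec (L : Model n →L[ℝ] F) (v : Model n) :
    L v = ∑ a, v a • L (stdVec n a) := by
  conv_lhs => rw [← sum_smul_stdVec v, map_sum]
  simp only [map_smul]

theorem clm_ext_stdVec {L L' : Model n →L[ℝ] F} (h : ∀ a, L (stdVec n a) = L' (stdVec n a)) :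
    L = L' := by
  ext v
  rw [map_eq_sum_stdVec L, map_eq_sum_stdVec L']
  simp only [h]

theorem contDiffOn_clm_of_stdVec {L : E → Model n →L[ℝ] F} {s : Set E} {k : ℕ∞ω}
    (h : ∀ a, ContDiffOn ℝ k (fun x => L x (stdVec n a)) s) : ContDiffOn ℝ k L s := by
  rw [contDiffOn_clm_apply]
  intro v
  simp only [map_eq_sum_stdVec _ v]
  exact ContDiffOn.sum fun a _ => (h a).const_smul _

theorem differentiableAt_of_contDiffOn {f : E → F} {U : Set E} {x : E} (hf : ContDiffOn ℝ ∞ f U)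
    (hU : IsOpen U) (hx : x ∈ U) : DifferentiableAt ℝ f x :=
  (hf.contDiffAt (hU.mem_nhds hx)).differentiableAt (by simp)

theorem partialDeriv_clm_apply {L : Model n → E →L[ℝ] F} {x : Model n}
    (hL : DifferentiableAt ℝ L x) (a : Fin n) (v : E) :
    partialDeriv a (fun y => L y v) x = fderiv ℝ L x (stdVec n a) v := by
  rw [partialDeriv, (hL.hasFDerivAt.clm_apply (hasFDerivAt_const v x)).fderiv]
  simp

end Model

section MatrixSmooth

variable {E ι 𝕜 : Type*} [NormedAddCommGroup E] [NormedSpace ℝ E] [Fintype ι] [DecidableEq ι]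
  [RCLike 𝕜] {X : E → Matrix ι ι 𝕜} {s : Set E} {k : ℕ∞ω}

theorem contDiffOn_matrix_det (hX : ∀ i j, ContDiffOn ℝ k (fun x => X x i j) s) :
    ContDiffOn ℝ k (fun x => (X x).det) s := by
  simp only [Matrix.det_apply]
  exact ContDiffOn.sum fun σ _ => (contDiffOn_prod fun i _ => hX _ _).const_smul _

theorem contDiffOn_matrix_inv (hX : ∀ i j, ContDiffOn ℝ k (fun x => X x i j) s)
    (hdet : ∀ x ∈ s, (X x).det ≠ 0) (i j : ι) : ContDiffOn ℝ k (fun x => (X x)⁻¹ i j) s := by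
  simp only [Matrix.inv_def, Matrix.smul_apply, Ring.inverse_eq_inv', Matrix.adjugate_apply,
    smul_eq_mul]
  refine ((contDiffOn_matrix_det hX).inv hdet).mul (contDiffOn_matrix_det fun l m => ?_)
  rcases eq_or_ne l j with rfl | hl
  · simpa using contDiffOn_const
  · simpa only [Matrix.updateRow_ne hl] using hX l m

end MatrixSmooth

/-! ### Forms and metrics read in a chart -/

section Charts

variable {n : ℕ} {M : Type*} [TopologicalSpace M] [ChartedSpace (Model n) M]
  {e : OpenPartialHomeomorph M (Model n)} {x : Model n}

theorem IsChart.mdifferentiable (he : IsChart e) : e.MDifferentiable (𝓡 n) (𝓡 n) :=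
  ⟨(contMDiffOn_of_mem_maximalAtlas he).mdifferentiableOn (by simp),
    (contMDiffOn_symm_of_mem_maximalAtlas he).mdifferentiableOn (by simp)⟩

theorem IsChart.mfderiv_symm_bijective [IsManifold (𝓡 n) ∞ M] (he : IsChart e)
    (hx : x ∈ e.target) : Function.Bijective (mfderiv (𝓡 n) (𝓡 n) e.symm x) :=
  have : IsManifold (𝓡 n) 1 M := IsManifold.of_le (n := ∞) (by simp)
  he.mdifferentiable.symm.mfderiv_bijective hx

namespace OneForm

variable {α : OneForm n M}

/-- The coordinate expression of a 1-form: its pullback along `e.symm`, a map from the model space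
to its complex-valued covectors. -/
def inChart (α : OneForm n M) (e : OpenPartialHomeomorph M (Model n)) (x : Model n) :
    Model n →L[ℝ] ℂ :=
  (α (e.symm x)).comp (mfderiv (𝓡 n) (𝓡 n) e.symm x)

theorem inChart_eq_zero_iff [IsManifold (𝓡 n) ∞ M] (he : IsChart e) (hx : x ∈ e.target) :
    α.inChart e x = 0 ↔ α (e.symm x) = 0 := by
  refine ⟨fun h => ?_, fun h => ?_⟩
  · ext w
    obtain ⟨v, rfl⟩ := (he.mfderiv_symm_bijective hx).surjective w
    exact congrArg (fun L : Model n →L[ℝ] ℂ => L v) h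
  · rw [inChart, h]
    rfl

theorem IsSmooth.contDiffOn_inChart (hα : α.IsSmooth) (he : IsChart e) :
    ContDiffOn ℝ ∞ (α.inChart e) e.target :=
  contDiffOn_clm_of_stdVec (hα e he)

theorem IsSmooth.differentiableAt_inChart (hα : α.IsSmooth) (he : IsChart e) (hx : x ∈ e.target) :
    DifferentiableAt ℝ (α.inChart e) x :=
  differentiableAt_of_contDiffOn (hα.contDiffOn_inChart he) e.open_target hx

theorem IsClosed.fderiv_inChart_symm (hc : α.IsClosed) (hα : α.IsSmooth) (he : IsChart e)
    (hx : x ∈ e.target) (u v : Model n) :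
    fderiv ℝ (α.inChart e) x u v = fderiv ℝ (α.inChart e) x v u := by
  have hd := hα.differentiableAt_inChart he hx
  suffices h : fderiv ℝ (α.inChart e) x = (fderiv ℝ (α.inChart e) x).flip from
    congrArg (fun B : Model n →L[ℝ] Model n →L[ℝ] ℂ => B u v) h
  refine clm_ext_stdVec fun a => clm_ext_stdVec fun b => ?_
  rw [ContinuousLinearMap.flip_apply, ← partialDeriv_clm_apply hd, ← partialDeriv_clm_apply hd]
  exact sub_eq_zero.1 (hc e he x hx a b)

end OneForm

namespace Metric

variable (g : Metric n M)

/-- The coordinate expression of a metric, as a bilinear form on the model space. -/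
def inChart (e : OpenPartialHomeomorph M (Model n)) (x : Model n) :
    Model n →L[ℝ] Model n →L[ℝ] ℝ :=
  let G : Model n →L[ℝ] Model n →L[ℝ] ℝ := g.val (e.symm x)
  let D : Model n →L[ℝ] Model n := mfderiv (𝓡 n) (𝓡 n) e.symm x
  G.bilinearComp D D

theorem inChart_stdVec (e : OpenPartialHomeomorph M (Model n)) (x : Model n) (a b : Fin n) :
    g.inChart e x (stdVec n a) (stdVec n b) = g.comp e a b x := rfl

theorem inChart_nondegenerate [IsManifold (𝓡 n) ∞ M] (he : IsChart e) (hx : x ∈ e.target)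
    {v : Model n} (hv : ∀ w, g.inChart e x v w = 0) : v = 0 := by
  obtain ⟨hinj, hsurj⟩ := he.mfderiv_symm_bijective hx
  refine hinj ((g.nondegenerate _ _ fun w => ?_).trans (map_zero _).symm)
  obtain ⟨w, rfl⟩ := hsurj w
  exact hv w

theorem contDiffOn_inChart (he : IsChart e) : ContDiffOn ℝ ∞ (g.inChart e) e.target :=
  contDiffOn_clm_of_stdVec fun a => contDiffOn_clm_of_stdVec fun b => g.smooth e he a b

theorem differentiableAt_inChart (he : IsChart e) (hx : x ∈ e.target) :
    DifferentiableAt ℝ (g.inChart e) x :=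
  differentiableAt_of_contDiffOn (g.contDiffOn_inChart he) e.open_target hx

theorem partialDeriv_comp (he : IsChart e) (hx : x ∈ e.target) (a b c : Fin n) :
    partialDeriv a (g.comp e b c) x
      = fderiv ℝ (g.inChart e) x (stdVec n a) (stdVec n b) (stdVec n c) := by
  have hd := g.differentiableAt_inChart he hx
  change partialDeriv a (fun y => g.inChart e y (stdVec n b) (stdVec n c)) x = _
  rw [partialDeriv_clm_apply (hd.clm_apply (differentiableAt_const _)), ← partialDeriv_clm_apply hd]
  rfl

/-- The matrix `g_{ab}` of a metric in a chart. -/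
def gram (e : OpenPartialHomeomorph M (Model n)) (x : Model n) : Matrix (Fin n) (Fin n) ℝ :=
  Matrix.of fun a b => g.comp e a b x

theorem det_gram_ne_zero [IsManifold (𝓡 n) ∞ M] (he : IsChart e) (hx : x ∈ e.target) :
    (g.gram e x).det ≠ 0 := by
  intro h
  obtain ⟨v, hv, hv0⟩ := Matrix.exists_vecMul_eq_zero_iff.2 h
  refine hv (congrArg WithLp.ofLp (g.inChart_nondegenerate he hx (v := WithLp.toLp 2 v) ?_))
  suffices g.inChart e x (WithLp.toLp 2 v) = 0 by simp [this]
  refine clm_ext_stdVec fun b => ?_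
  rw [map_eq_sum_stdVec (g.inChart e x)]
  simpa [Matrix.vecMul, dotProduct, gram, inChart_stdVec] using congrFun hv0 b

theorem contDiffOn_christoffel [IsManifold (𝓡 n) ∞ M] (he : IsChart e) (c a b : Fin n) :
    ContDiffOn ℝ ∞ (g.christoffel e c a b) e.target := by
  have hpartial : ∀ a b c, ContDiffOn ℝ ∞ (partialDeriv a (g.comp e b c)) e.target := fun a b c =>
    ((g.smooth e he b c).fderiv_of_isOpen e.open_target (m := ∞) (by simp)).clm_apply
      contDiffOn_const
  exact ContDiffOn.sum fun d _ =>
    (contDiffOn_matrix_inv (X := g.gram e) (g.smooth e he) (fun x hx => g.det_gram_ne_zero he hx)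
      c d).mul (contDiffOn_const.mul (((hpartial _ _ _).add (hpartial _ _ _)).sub (hpartial _ _ _)))

theorem christoffel_symm (e : OpenPartialHomeomorph M (Model n)) (c a b : Fin n) :
    g.christoffel e c a b = g.christoffel e c b a := by
  funext x
  have hg : g.comp e a b = g.comp e b a := funext fun _ => g.symm _ _ _
  simp only [christoffel, hg]
  exact Finset.sum_congr rfl fun d _ => by ring

/-- The Christoffel symbols at `x` as the bilinear map `(u, v) ↦ Γ^c_{ab} u^a v^b`. -/
def christoffelMap (e : OpenPartialHomeomorph M (Model n)) (x : Model n) :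
    Model n →L[ℝ] Model n →L[ℝ] Model n :=
  ∑ a, ∑ b, ∑ c, g.christoffel e c a b x •
    (EuclideanSpace.proj a).smulRight ((EuclideanSpace.proj b).smulRight (stdVec n c))

theorem christoffelMap_apply (e : OpenPartialHomeomorph M (Model n)) (x u v : Model n)
    (c : Fin n) :
    g.christoffelMap e x u v c = ∑ a, ∑ b, g.christoffel e c a b x * u a * v b := by
  simp [christoffelMap, stdVec, Pi.single_apply, mul_assoc]

theorem christoffelMap_stdVec (e : OpenPartialHomeomorph M (Model n)) (x : Model n)
    (a b c : Fin n) :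
    g.christoffelMap e x (stdVec n a) (stdVec n b) c = g.christoffel e c a b x := by
  simp [christoffelMap_apply, stdVec]

theorem christoffelMap_symm (e : OpenPartialHomeomorph M (Model n)) (x u v : Model n) :
    g.christoffelMap e x u v = g.christoffelMap e x v u := by
  ext c
  rw [christoffelMap_apply, christoffelMap_apply, Finset.sum_comm]
  refine Finset.sum_congr rfl fun a _ => Finset.sum_congr rfl fun b _ => ?_
  rw [g.christoffel_symm e c b a]
  ring

theorem contDiffOn_christoffelMap [IsManifold (𝓡 n) ∞ M] (he : IsChart e) :
    ContDiffOn ℝ ∞ (g.christoffelMap e) e.target :=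
  contDiffOn_clm_of_stdVec fun a => contDiffOn_clm_of_stdVec fun b =>
    contDiffOn_euclidean.2 fun c => by
      simpa only [christoffelMap_stdVec] using g.contDiffOn_christoffel he c a b

theorem differentiableAt_christoffelMap [IsManifold (𝓡 n) ∞ M] (he : IsChart e)
    (hx : x ∈ e.target) : DifferentiableAt ℝ (g.christoffelMap e) x :=
  differentiableAt_of_contDiffOn (g.contDiffOn_christoffelMap he) e.open_target hx

theorem inChart_christoffelMap [IsManifold (𝓡 n) ∞ M] (he : IsChart e) (hx : x ∈ e.target)
    (a b d : Fin n) :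
    2 * g.inChart e x (stdVec n d) (g.christoffelMap e x (stdVec n a) (stdVec n b))
      = fderiv ℝ (g.inChart e) x (stdVec n a) (stdVec n d) (stdVec n b)
        + fderiv ℝ (g.inChart e) x (stdVec n b) (stdVec n d) (stdVec n a)
        - fderiv ℝ (g.inChart e) x (stdVec n d) (stdVec n a) (stdVec n b) := by
  simp only [← g.partialDeriv_comp he hx]
  set lowered : Fin n → ℝ := fun d => (1 / 2 : ℝ) * (partialDeriv a (g.comp e d b) x
    + partialDeriv b (g.comp e d a) x - partialDeriv d (g.comp e a b) x) with hlow
  have hinv : (g.gram e x).mulVec ((g.gram e x)⁻¹.mulVec lowered) = lowered := by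
    rw [Matrix.mulVec_mulVec, Matrix.mul_nonsing_inv _ (g.det_gram_ne_zero he hx).isUnit,
      Matrix.one_mulVec]
  have hraise : g.inChart e x (stdVec n d) (g.christoffelMap e x (stdVec n a) (stdVec n b))
      = (g.gram e x).mulVec ((g.gram e x)⁻¹.mulVec lowered) d := by
    rw [map_eq_sum_stdVec]
    refine Finset.sum_congr rfl fun c _ => ?_
    rw [christoffelMap_stdVec, inChart_stdVec, smul_eq_mul, mul_comm]
    rfl
  rw [hraise, hinv, hlow]
  ring

end Metric

end Charts

/-! ### Parallel 1-forms -/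

theorem eqOn_zero_of_norm_fderiv_le {E F : Type*} [NormedAddCommGroup E] [NormedSpace ℝ E]
    [NormedAddCommGroup F] [NormedSpace ℝ F] {f : E → F} {U : Set E} {K : ℝ} {x₀ : E}
    (hU : Convex ℝ U) (hf : ∀ x ∈ U, DifferentiableAt ℝ f x)
    (hK : ∀ x ∈ U, ‖fderiv ℝ f x‖ ≤ K * ‖f x‖) (hx₀ : x₀ ∈ U) (h0 : f x₀ = 0) :
    Set.EqOn f 0 U := by
  intro x hx
  let l : ℝ → E := AffineMap.lineMap x₀ x
  have hl : ∀ t ∈ Set.Icc (0 : ℝ) 1, l t ∈ U := fun t ht =>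
    hU.segment_subset hx₀ hx (segment_eq_image_lineMap ℝ x₀ x ▸ Set.mem_image_of_mem _ ht)
  have hderiv : ∀ t ∈ Set.Icc (0 : ℝ) 1, HasDerivAt (f ∘ l) (fderiv ℝ f (l t) (x - x₀)) t :=
    fun t ht => (hf _ (hl t ht)).hasFDerivAt.comp_hasDerivAt t AffineMap.hasDerivAt_lineMap
  have hzero : (f ∘ l) 1 = 0 := by
    refine eq_zero_of_abs_deriv_le_mul_abs_self_of_eq_zero_right (K := K * ‖x - x₀‖)
      (fun t ht => (hderiv t ht).continuousAt.continuousWithinAt)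
      (fun t ht => (hderiv t (Set.Ico_subset_Icc_self ht)).hasDerivWithinAt)
      (by simpa [l] using h0) (fun t ht => ?_) 1 (Set.right_mem_Icc.2 zero_le_one)
    have ht' := Set.Ico_subset_Icc_self ht
    calc ‖fderiv ℝ f (l t) (x - x₀)‖ ≤ ‖fderiv ℝ f (l t)‖ * ‖x - x₀‖ :=
          ContinuousLinearMap.le_opNorm _ _
      _ ≤ K * ‖f (l t)‖ * ‖x - x₀‖ := by gcongr; exact hK _ (hl t ht')
      _ = K * ‖x - x₀‖ * ‖(f ∘ l) t‖ := by rw [Function.comp_apply]; ring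
  simpa [l] using hzero

section Parallel

variable {n : ℕ} {M : Type*} [TopologicalSpace M] [ChartedSpace (Model n) M]
  {e : OpenPartialHomeomorph M (Model n)} {x : Model n}

variable (e) in
/-- The 1-forms that are smooth in the chart `e` and parallel there for the Levi-Civita connection
of `g`: `∂_a α_b = Γ^c_{ab} α_c`. -/
def parallelForms (g : Metric n M) : Submodule ℂ (OneForm n M) where
  carrier := {α | ContDiffOn ℝ ∞ (α.inChart e) e.target ∧ ∀ x ∈ e.target, ∀ u v,
    fderiv ℝ (α.inChart e) x u v = α.inChart e x (g.christoffelMap e x u v)}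
  zero_mem' := by
    have hzero : (0 : OneForm n M).inChart e = fun _ => 0 := rfl
    exact ⟨hzero ▸ contDiffOn_const, fun x _ u v => by simp [hzero]⟩
  add_mem' {α β} hα hβ := by
    have hadd : (α + β).inChart e = α.inChart e + β.inChart e := rfl
    refine ⟨hadd ▸ hα.1.add hβ.1, fun x hx u v => ?_⟩
    rw [hadd, fderiv_add (differentiableAt_of_contDiffOn hα.1 e.open_target hx)
      (differentiableAt_of_contDiffOn hβ.1 e.open_target hx)]
    exact congrArg₂ (· + ·) (hα.2 x hx u v) (hβ.2 x hx u v)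
  smul_mem' z α hα := by
    have hsmul : (z • α).inChart e = z • α.inChart e := rfl
    refine ⟨hsmul ▸ contDiffOn_const.smul hα.1, fun x hx u v => ?_⟩
    rw [hsmul, fderiv_const_smul (differentiableAt_of_contDiffOn hα.1 e.open_target hx)]
    exact congrArg (z • ·) (hα.2 x hx u v)

variable {g : Metric n M} {α : OneForm n M}

theorem mem_parallelForms_of_stdVec (hα : ContDiffOn ℝ ∞ (α.inChart e) e.target)
    (h : ∀ x ∈ e.target, ∀ a b, fderiv ℝ (α.inChart e) x (stdVec n a) (stdVec n b)
      = α.inChart e x (g.christoffelMap e x (stdVec n a) (stdVec n b))) :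
    α ∈ parallelForms e g := by
  refine ⟨hα, fun x hx u v => ?_⟩
  suffices hbil : fderiv ℝ (α.inChart e) x
      = (ContinuousLinearMap.compL ℝ (Model n) (Model n) ℂ (α.inChart e x)).comp
        (g.christoffelMap e x) by
    rw [hbil]
    rfl
  exact clm_ext_stdVec fun a => clm_ext_stdVec fun b => h x hx a b

namespace Metric

/-- The vector `R(u, w) v` of the curvature of the Levi-Civita connection in a chart. -/
def curvatureMap (g : Metric n M) (e : OpenPartialHomeomorph M (Model n)) (x u w v : Model n) :
    Model n :=
  fderiv ℝ (g.christoffelMap e) x u w v - fderiv ℝ (g.christoffelMap e) x w u v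
    + g.christoffelMap e x u (g.christoffelMap e x w v)
    - g.christoffelMap e x w (g.christoffelMap e x u v)

theorem curvatureMap_stdVec [IsManifold (𝓡 n) ∞ M] (he : IsChart e) (hx : x ∈ e.target)
    (a b c d : Fin n) :
    g.curvatureMap e x (stdVec n c) (stdVec n d) (stdVec n b) a = g.curvatureUp e a b c d x := by
  have hd := g.differentiableAt_christoffelMap he hx
  have hpartial : ∀ c d, fderiv ℝ (g.christoffelMap e) x (stdVec n c) (stdVec n d) (stdVec n b) a
      = partialDeriv c (g.christoffel e a b d) x := by
    intro c d
    have hentry := (EuclideanSpace.proj a : Model n →L[ℝ] ℝ).hasFDerivAt.comp x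
      ((hd.hasFDerivAt.clm_apply (hasFDerivAt_const (stdVec n d) x)).clm_apply
        (hasFDerivAt_const (stdVec n b) x))
    have hfun : g.christoffel e a b d = EuclideanSpace.proj a ∘
        fun y => g.christoffelMap e y (stdVec n d) (stdVec n b) := by
      funext y
      exact (g.christoffel_symm e a b d ▸ g.christoffelMap_stdVec e y d b a).symm
    rw [partialDeriv, hfun, hentry.fderiv]
    simp
  have hcomp : ∀ c d, g.christoffelMap e x (stdVec n c)
      (g.christoffelMap e x (stdVec n d) (stdVec n b)) a
        = ∑ k, g.christoffel e a k c x * g.christoffel e k b d x := by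
    intro c d
    rw [map_eq_sum_stdVec]
    simp [christoffelMap_stdVec, g.christoffel_symm e a c, g.christoffel_symm e _ d b, mul_comm]
  simp [curvatureMap, curvatureUp, hpartial, hcomp]

end Metric

theorem inChart_curvatureMap_eq_zero [IsManifold (𝓡 n) ∞ M] (he : IsChart e)
    (hα : α ∈ parallelForms e g) (hx : x ∈ e.target) (u w v : Model n) :
    α.inChart e x (g.curvatureMap e x u w v) = 0 := by
  have hnhds := e.open_target.mem_nhds hx
  have hd := differentiableAt_of_contDiffOn hα.1 e.open_target hx
  have hdΓ := g.differentiableAt_christoffelMap he hx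
  have hd2 : DifferentiableAt ℝ (fderiv ℝ (α.inChart e)) x :=
    differentiableAt_of_contDiffOn (hα.1.fderiv_of_isOpen e.open_target (m := ∞) (by simp))
      e.open_target hx
  have hsecond : ∀ u w, fderiv ℝ (fderiv ℝ (α.inChart e)) x u w v
      = α.inChart e x (g.christoffelMap e x u (g.christoffelMap e x w v)
        + fderiv ℝ (g.christoffelMap e) x u w v) := by
    intro u w
    have heq : (fun y => fderiv ℝ (α.inChart e) y w v)
        =ᶠ[nhds x] fun y => α.inChart e y (g.christoffelMap e y w v) :=
      Filter.eventually_of_mem hnhds fun y hy => hα.2 y hy w v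
    have hleft := (hd2.hasFDerivAt.clm_apply (hasFDerivAt_const w x)).clm_apply
      (hasFDerivAt_const v x)
    have hright := hd.hasFDerivAt.clm_apply
      ((hdΓ.hasFDerivAt.clm_apply (hasFDerivAt_const w x)).clm_apply (hasFDerivAt_const v x))
    have h := congrArg (fun L : Model n →L[ℝ] ℂ => L u)
      (hleft.unique (hright.congr_of_eventuallyEq heq))
    simpa [hα.2 x hx, add_comm] using h
  have hsymm : IsSymmSndFDerivAt ℝ (α.inChart e) x :=
    (hα.1.contDiffAt hnhds).isSymmSndFDerivAt
      (by simpa using! WithTop.coe_le_coe.2 (le_top : (2 : ℕ∞) ≤ ⊤))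
  have h := congrArg (fun L : Model n →L[ℝ] ℂ => L v) (hsymm.eq u w)
  simp only [hsecond, map_add] at h
  simp only [Metric.curvatureMap, map_add, map_sub]
  linear_combination h

end Parallel

section Uniqueness

variable {n : ℕ} {M : Type*} [TopologicalSpace M] [ChartedSpace (Model n) M]
  [IsManifold (𝓡 n) ∞ M] {e : OpenPartialHomeomorph M (Model n)} {g : Metric n M}
  {α : OneForm n M}

theorem eqOn_zero_of_mem_parallelForms (he : IsChart e) (hα : α ∈ parallelForms e g)
    {U : Set (Model n)} (hU : Convex ℝ U) (hUe : U ⊆ e.target) {K : ℝ}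
    (hK : ∀ x ∈ U, ‖g.christoffelMap e x‖ ≤ K) {x₀ : Model n} (hx₀ : x₀ ∈ U)
    (h0 : α (e.symm x₀) = 0) {x : Model n} (hx : x ∈ U) : α (e.symm x) = 0 := by
  suffices hzero : Set.EqOn (α.inChart e) 0 U from
    (OneForm.inChart_eq_zero_iff he (hUe hx)).1 (hzero hx)
  refine eqOn_zero_of_norm_fderiv_le (K := K) hU
    (fun y hy => differentiableAt_of_contDiffOn hα.1 e.open_target (hUe hy)) (fun y hy => ?_) hx₀
    ((OneForm.inChart_eq_zero_iff he (hUe hx₀)).2 h0)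
  have hK0 : 0 ≤ K := (ContinuousLinearMap.opNorm_nonneg _).trans (hK y hy)
  refine ContinuousLinearMap.opNorm_le_bound₂ _ (by positivity) fun u v => ?_
  rw [hα.2 y (hUe hy)]
  calc ‖α.inChart e y (g.christoffelMap e y u v)‖
      ≤ ‖α.inChart e y‖ * ‖g.christoffelMap e y u v‖ := ContinuousLinearMap.le_opNorm _ _
    _ ≤ ‖α.inChart e y‖ * (‖g.christoffelMap e y‖ * ‖u‖ * ‖v‖) := by
        gcongr
        exact ContinuousLinearMap.le_opNorm₂ _ _ _
    _ ≤ ‖α.inChart e y‖ * (K * ‖u‖ * ‖v‖) := by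
        gcongr
        exact hK y hy
    _ = K * ‖α.inChart e y‖ * ‖u‖ * ‖v‖ := by ring

theorem eventually_eq_zero_iff_of_mem_parallelForms (he : IsChart e)
    (hα : α ∈ parallelForms e g) {p : M} (hp : p ∈ e.source) :
    ∀ᶠ q in nhds p, (α q = 0 ↔ α p = 0) := by
  have hcont : ContinuousAt (fun x => ‖g.christoffelMap e x‖) (e p) :=
    (continuous_norm (E := Model n →L[ℝ] Model n →L[ℝ] Model n)).continuousAt.comp
      (g.differentiableAt_christoffelMap he (e.map_source hp)).continuousAt
  obtain ⟨r, hr, hball⟩ := Metric.eventually_nhds_iff_ball.1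
    ((hcont.eventually_lt_const (lt_add_one _)).and (e.open_target.mem_nhds (e.map_source hp)))
  have hspread : ∀ x ∈ Metric.ball (e p) r, ∀ y ∈ Metric.ball (e p) r,
      α (e.symm x) = 0 → α (e.symm y) = 0 := fun x hx y hy h0 =>
    eqOn_zero_of_mem_parallelForms he hα (convex_ball _ _) (fun z hz => (hball z hz).2)
      (fun z hz => (hball z hz).1.le) hx h0 hy
  filter_upwards [e.open_source.mem_nhds hp,
    (e.continuousAt hp).preimage_mem_nhds (Metric.ball_mem_nhds _ hr)] with q hq hqball
  rw [← e.left_inv hq, ← e.left_inv hp]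
  exact ⟨hspread _ hqball _ (Metric.mem_ball_self hr), hspread _ (Metric.mem_ball_self hr) _ hqball⟩

theorem eq_zero_of_mem_parallelForms [PreconnectedSpace M]
    (hα : ∀ p, ∃ e : OpenPartialHomeomorph M (Model n),
      IsChart e ∧ p ∈ e.source ∧ α ∈ parallelForms e g) {p₀ : M} (h0 : α p₀ = 0) : α = 0 := by
  have hconst : IsLocallyConstant fun p => α p = 0 :=
    (IsLocallyConstant.iff_eventually_eq _).2 fun p => by
      obtain ⟨e, he, hp, hpar⟩ := hα p
      exact (eventually_eq_zero_iff_of_mem_parallelForms he hpar hp).mono fun q hq => propext hq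
  funext p
  exact (hconst.apply_eq_of_preconnectedSpace p₀ p).mp h0

end Uniqueness

/-! ### Diagonalized metrics -/

section Diagonal

variable {n : ℕ} {M : Type*} [TopologicalSpace M] [ChartedSpace (Model n) M]
  {e : OpenPartialHomeomorph M (Model n)} {x : Model n} {g : Metric n M}

/-- The matrix `A_{Ia}` of the components of `n` 1-forms in a chart. -/
def frame (A : Fin n → OneForm n M) (e : OpenPartialHomeomorph M (Model n)) (x : Model n) :
    Matrix (Fin n) (Fin n) ℂ :=
  Matrix.of fun I a => (A I).comp e a x

namespace Metric

/-- The metric is `∑ I, c_I A_I ⊗ A_I`. The weights cover both a factorization (`c = 1`) and a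
Cartesian form (`c` a family of signs). -/
def IsDiagonalizedBy (g : Metric n M) (c : Fin n → ℂ) (A : Fin n → OneForm n M) : Prop :=
  ∀ (p : M) (v w : TangentSpace (𝓡 n) p), (g.val p v w : ℂ) = ∑ I, c I * (A I p v * A I p w)

end Metric

namespace Metric.IsDiagonalizedBy

variable {c : Fin n → ℂ} {A : Fin n → OneForm n M}

theorem inChart_apply (hg : g.IsDiagonalizedBy c A) (v w : Model n) :
    (g.inChart e x v w : ℂ) = ∑ I, c I * ((A I).inChart e x v * (A I).inChart e x w) :=
  hg _ _ _

theorem mapMatrix_gram (hg : g.IsDiagonalizedBy c A) :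
    Complex.ofRealHom.mapMatrix (g.gram e x)
      = (frame A e x).transpose * Matrix.diagonal c * frame A e x := by
  ext a b
  rw [Matrix.mul_apply]
  simp only [Matrix.mul_diagonal, Matrix.transpose_apply]
  exact (hg _ _ _).trans (Finset.sum_congr rfl fun I _ =>
    (mul_left_comm _ _ _).trans (mul_assoc _ _ _).symm)

theorem det_frame_mul_det_frame_ne_zero [IsManifold (𝓡 n) ∞ M]
    (hg : g.IsDiagonalizedBy c A) (he : IsChart e) (hx : x ∈ e.target) :
    ((frame A e x).transpose * Matrix.diagonal c).det * (frame A e x).det ≠ 0 := by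
  rw [← Matrix.det_mul, ← hg.mapMatrix_gram, ← RingHom.map_det]
  exact Complex.ofReal_ne_zero.2 (g.det_gram_ne_zero he hx)

theorem fderiv_inChart (hg : g.IsDiagonalizedBy c A) (he : IsChart e) (hx : x ∈ e.target)
    (hA : ∀ I, (A I).IsSmooth) (u v w : Model n) :
    (fderiv ℝ (g.inChart e) x u v w : ℂ)
      = ∑ I, c I * (fderiv ℝ ((A I).inChart e) x u v * (A I).inChart e x w
        + (A I).inChart e x v * fderiv ℝ ((A I).inChart e) x u w) := by
  have heval : ∀ (I : Fin n) (v : Model n), HasFDerivAt (fun y => (A I).inChart e y v)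
      ((fderiv ℝ ((A I).inChart e) x).flip v) x := fun I v => by
    simpa using ((hA I).differentiableAt_inChart he hx).hasFDerivAt.clm_apply
      (hasFDerivAt_const v x)
  have hleft := Complex.ofRealCLM.hasFDerivAt.comp x
    (((g.differentiableAt_inChart he hx).hasFDerivAt.clm_apply
      (hasFDerivAt_const v x)).clm_apply (hasFDerivAt_const w x))
  have hright := HasFDerivAt.fun_sum fun I (_ : I ∈ Finset.univ) =>
    ((heval I v).mul (heval I w)).const_mul (c I)
  have h := congrArg (fun L : Model n →L[ℝ] ℂ => L u) (hleft.unique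
    (hright.congr_of_eventuallyEq (.of_forall fun y => hg.inChart_apply v w)))
  simpa [mul_add, add_comm, mul_comm] using h

/- The forms being closed, every `∂_d A_{Ia}` equals `∂_a A_{Id}`, so that only
`2 ∑ I, c_I A_{Id} ∂_a A_{Ib}` survives in the Koszul formula. -/
theorem sum_mul_covariant_eq_zero [IsManifold (𝓡 n) ∞ M] (hg : g.IsDiagonalizedBy c A)
    (he : IsChart e) (hx : x ∈ e.target) (hA : ∀ I, (A I).IsSmooth) (hcl : ∀ I, (A I).IsClosed)
    (a b d : Fin n) :
    ∑ I, c I * ((A I).inChart e x (stdVec n d)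
      * (fderiv ℝ ((A I).inChart e) x (stdVec n a) (stdVec n b)
        - (A I).inChart e x (g.christoffelMap e x (stdVec n a) (stdVec n b)))) = 0 := by
  have hkoszul := congrArg ((↑) : ℝ → ℂ) (g.inChart_christoffelMap he hx a b d)
  push_cast at hkoszul
  simp only [hg.inChart_apply, hg.fderiv_inChart he hx hA] at hkoszul
  simp only [fun I => (hcl I).fderiv_inChart_symm (hA I) he hx (stdVec n d),
    fun I => (hcl I).fderiv_inChart_symm (hA I) he hx (stdVec n b) (stdVec n a)] at hkoszul
  rw [Finset.mul_sum, ← Finset.sum_add_distrib, ← Finset.sum_sub_distrib,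
    ← sub_eq_zero, ← Finset.sum_sub_distrib] at hkoszul
  rw [← mul_right_inj' (neg_ne_zero.2 (two_ne_zero' ℂ)), mul_zero, ← hkoszul, Finset.mul_sum]
  exact Finset.sum_congr rfl fun I _ => by ring

theorem mem_parallelForms [IsManifold (𝓡 n) ∞ M] (hg : g.IsDiagonalizedBy c A)
    (he : IsChart e) (hA : ∀ I, (A I).IsSmooth) (hcl : ∀ I, (A I).IsClosed) (I : Fin n) :
    A I ∈ parallelForms e g := by
  refine mem_parallelForms_of_stdVec ((hA I).contDiffOn_inChart he) fun x hx a b => ?_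
  let Z : Fin n → ℂ := fun I => fderiv ℝ ((A I).inChart e) x (stdVec n a) (stdVec n b)
    - (A I).inChart e x (g.christoffelMap e x (stdVec n a) (stdVec n b))
  suffices hZ : Z = 0 from sub_eq_zero.1 (congrFun hZ I)
  refine Matrix.eq_zero_of_mulVec_eq_zero
    (left_ne_zero_of_mul (hg.det_frame_mul_det_frame_ne_zero he hx)) (funext fun d => ?_)
  rw [Pi.zero_apply, ← hg.sum_mul_covariant_eq_zero he hx hA hcl a b d]
  simp only [Matrix.mulVec, dotProduct, Matrix.mul_diagonal, Matrix.transpose_apply,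
    mul_comm _ (c _), mul_assoc]
  rfl

theorem isNonCurved [IsManifold (𝓡 n) ∞ M] (hg : g.IsDiagonalizedBy c A)
    (hpar : ∀ e, IsChart e → ∀ I, A I ∈ parallelForms e g) : g.IsNonCurved := by
  intro e he x hx a b j k
  have hzero : g.curvatureMap e x (stdVec n j) (stdVec n k) (stdVec n b) = 0 :=
    g.inChart_nondegenerate he hx fun w => by
      rw [← Complex.ofReal_eq_zero, hg.inChart_apply]
      simp only [inChart_curvatureMap_eq_zero he (hpar e he _) hx, zero_mul, mul_zero,
        Finset.sum_const_zero]
  refine Finset.sum_eq_zero fun i _ => ?_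
  rw [← g.curvatureMap_stdVec he hx i b j k, hzero, PiLp.zero_apply, mul_zero]

end Metric.IsDiagonalizedBy

end Diagonal

/-! ### Exactness of parallel forms -/

section Exactness

variable {n : ℕ} {M : Type*} [TopologicalSpace M] [ChartedSpace (Model n) M]
  {e : OpenPartialHomeomorph M (Model n)} {x : Model n}

variable (n) in
/-- The differential of a complex function, as a 1-form. -/
def OneForm.differential (φ : M → ℂ) : OneForm n M :=
  fun p => mfderiv (𝓡 n) 𝓘(ℝ, ℂ) φ p

theorem OneForm.isExact_differential {φ : M → ℂ} (hφ : ContMDiff (𝓡 n) 𝓘(ℝ, ℂ) ∞ φ) :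
    (OneForm.differential n φ).IsExact :=
  ⟨φ, hφ, fun _ _ => rfl⟩

theorem contDiffOn_comp_symm {F : Type*} [NormedAddCommGroup F] [NormedSpace ℝ F] {φ : M → F}
    (hφ : ContMDiff (𝓡 n) 𝓘(ℝ, F) ∞ φ) (he : IsChart e) :
    ContDiffOn ℝ ∞ (φ ∘ e.symm) e.target :=
  (hφ.comp_contMDiffOn (contMDiffOn_symm_of_mem_maximalAtlas he)).contDiffOn

theorem OneForm.inChart_differential {φ : M → ℂ} (hφ : ContMDiff (𝓡 n) 𝓘(ℝ, ℂ) ∞ φ)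
    (he : IsChart e) (hx : x ∈ e.target) :
    (OneForm.differential n φ).inChart e x = fderiv ℝ (φ ∘ e.symm) x :=
  (mfderiv_comp x (hφ.mdifferentiableAt (by simp))
    (he.mdifferentiable.mdifferentiableAt_symm hx)).symm.trans mfderiv_eq_fderiv

theorem OneForm.contDiffOn_inChart_differential {φ : M → ℂ}
    (hφ : ContMDiff (𝓡 n) 𝓘(ℝ, ℂ) ∞ φ) (he : IsChart e) :
    ContDiffOn ℝ ∞ ((OneForm.differential n φ).inChart e) e.target :=
  ((contDiffOn_comp_symm hφ he).fderiv_of_isOpen e.open_target (m := ∞) (by simp)).congr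
    fun _ hx => OneForm.inChart_differential hφ he hx

theorem OneForm.IsExact.exists_eq_differential {α : OneForm n M} (hα : α.IsExact) :
    ∃ φ : M → ℂ, ContMDiff (𝓡 n) 𝓘(ℝ, ℂ) ∞ φ ∧ α = OneForm.differential n φ :=
  let ⟨φ, hφ, h⟩ := hα
  ⟨φ, hφ, funext fun p => ContinuousLinearMap.ext (h p)⟩

theorem OneForm.IsExact.isSmooth {α : OneForm n M} (hα : α.IsExact) : α.IsSmooth := by
  obtain ⟨φ, hφ, rfl⟩ := hα.exists_eq_differential
  exact fun _ he _ => (OneForm.contDiffOn_inChart_differential hφ he).clm_apply contDiffOn_const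

theorem OneForm.IsExact.isClosed {α : OneForm n M} (hα : α.IsExact) : α.IsClosed := by
  have hsmooth := hα.isSmooth
  obtain ⟨φ, hφ, rfl⟩ := hα.exists_eq_differential
  intro e he x hx a b
  have hnhds := e.open_target.mem_nhds hx
  have hsymm : IsSymmSndFDerivAt ℝ (φ ∘ e.symm) x :=
    ((contDiffOn_comp_symm hφ he).contDiffAt hnhds).isSymmSndFDerivAt
      (by simpa using! WithTop.coe_le_coe.2 (le_top : (2 : ℕ∞) ≤ ⊤))
  have hfderiv : fderiv ℝ ((OneForm.differential n φ).inChart e) x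
      = fderiv ℝ (fderiv ℝ (φ ∘ e.symm)) x :=
    Filter.EventuallyEq.fderiv_eq (Filter.eventually_of_mem hnhds fun _ hy =>
      OneForm.inChart_differential hφ he hy)
  have hpartial : ∀ a b, partialDeriv a ((OneForm.differential n φ).comp e b) x
      = fderiv ℝ (fderiv ℝ (φ ∘ e.symm)) x (stdVec n a) (stdVec n b) := fun a b =>
    hfderiv ▸ partialDeriv_clm_apply (hsmooth.differentiableAt_inChart he hx) a (stdVec n b)
  rw [OneForm.extDerivComp, hpartial, hpartial, hsymm.eq, sub_self]

variable (n M) in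
/-- The exact 1-forms, as a complex vector space. -/
def exactForms : Submodule ℂ (OneForm n M) where
  carrier := {α | α.IsExact}
  zero_mem' := ⟨fun _ => 0, contMDiff_const, fun p v => by rw [mfderiv_const]; rfl⟩
  add_mem' := by
    rintro α β ⟨φ, hφ, hα⟩ ⟨ψ, hψ, hβ⟩
    refine ⟨φ + ψ, hφ.add hψ, fun p v => ?_⟩
    rw [mfderiv_add (hφ.mdifferentiableAt (by simp)) (hψ.mdifferentiableAt (by simp))]
    exact congrArg₂ (· + ·) (hα p v) (hβ p v)
  smul_mem' := by
    rintro z α ⟨φ, hφ, hα⟩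
    let L : ℂ →L[ℝ] ℂ := ContinuousLinearMap.mul ℝ ℂ z
    refine ⟨L ∘ φ, L.contMDiff.comp hφ, fun p v => ?_⟩
    rw [mfderiv_comp p L.mdifferentiableAt (hφ.mdifferentiableAt (by simp)),
      ContinuousLinearMap.mfderiv_eq]
    exact congrArg (z * ·) (hα p v)

variable [IsManifold (𝓡 n) ∞ M] {g : Metric n M} {α : OneForm n M}

theorem apply_mem_span_of_det_frame_ne_zero {B : Fin n → OneForm n M} (he : IsChart e)
    (hx : x ∈ e.target) (hdet : (frame B e x).det ≠ 0) :
    α (e.symm x) ∈ Submodule.span ℂ (Set.range fun J => B J (e.symm x)) := by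
  let k : Fin n → ℂ := Matrix.vecMul (fun a => α.comp e a x) (frame B e x)⁻¹
  have hk : Matrix.vecMul k (frame B e x) = fun a => α.comp e a x := by
    rw [Matrix.vecMul_vecMul, Matrix.nonsing_inv_mul _ hdet.isUnit, Matrix.vecMul_one]
  refine (Submodule.mem_span_range_iff_exists_fun ℂ).2 ⟨k, ?_⟩
  suffices h : (α - ∑ J, k J • B J).inChart e x = 0 by
    simpa using (sub_eq_zero.1 ((OneForm.inChart_eq_zero_iff he hx).1 h)).symm
  refine clm_ext_stdVec fun a => ?_
  change (α (e.symm x) - (∑ J, k J • B J) (e.symm x)) (coordVec e x a) = 0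
  rw [sub_apply, Finset.sum_apply, sum_apply]
  exact sub_eq_zero.2 (congrFun hk a).symm

theorem isExact_of_mem_parallelForms [PreconnectedSpace M] {ι : Type*} {B : ι → OneForm n M}
    (hB : ∀ J, (B J).IsExact)
    (hpar : ∀ p, ∃ e : OpenPartialHomeomorph M (Model n), IsChart e ∧ p ∈ e.source ∧
      α ∈ parallelForms e g ∧ ∀ J, B J ∈ parallelForms e g)
    {p₀ : M} (hspan : α p₀ ∈ Submodule.span ℂ (Set.range fun J => B J p₀)) : α.IsExact := by
  obtain ⟨β, hβ, hβp⟩ : ∃ β ∈ Submodule.span ℂ (Set.range B), β p₀ = α p₀ := by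
    let ev : OneForm n M →ₗ[ℂ] TangentSpace (𝓡 n) p₀ →L[ℝ] ℂ := LinearMap.proj p₀
    change α p₀ ∈ Submodule.span ℂ (Set.range (ev ∘ B)) at hspan
    rwa [Set.range_comp, Submodule.span_image] at hspan
  have hdiff : α - β = 0 := by
    refine eq_zero_of_mem_parallelForms (g := g) (p₀ := p₀) (fun p => ?_) (by simp [hβp])
    obtain ⟨e, he, hp, hα, hBe⟩ := hpar p
    exact ⟨e, he, hp, Submodule.sub_mem _ hα
      (Submodule.span_le.2 (Set.range_subset_iff.2 hBe) hβ)⟩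
  rw [sub_eq_zero.1 hdiff]
  exact Submodule.span_le (p := exactForms n M) |>.2 (Set.range_subset_iff.2 hB) hβ

end Exactness

/-! ### Cartesian metrics and null connections -/

section Cartesian

variable {n : ℕ} {M : Type*} [TopologicalSpace M] [ChartedSpace (Model n) M]
  [IsManifold (𝓡 n) ∞ M] [ConnectedSpace M] {g : Metric n M} {α : OneForm n M}

theorem Metric.IsDiagonalizedBy.isExact_of_mem_parallelForms {c : Fin n → ℂ}
    {B : Fin n → OneForm n M} (hg : g.IsDiagonalizedBy c B) (hB : ∀ J, (B J).IsExact)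
    (hα : ∀ e, IsChart e → α ∈ parallelForms e g) : α.IsExact := by
  have hchart (p : M) : IsChart (chartAt (Model n) p) := IsManifold.chart_mem_maximalAtlas p
  obtain ⟨p₀⟩ := (inferInstance : Nonempty M)
  have hx₀ := mem_chart_target (Model n) p₀
  exact Takagi.isExact_of_mem_parallelForms hB
    (fun p => ⟨_, hchart p, mem_chart_source _ p, hα _ (hchart p), fun J => hg.mem_parallelForms
      (hchart p) (fun J => (hB J).isSmooth) (fun J => (hB J).isClosed) J⟩)
    (apply_mem_span_of_det_frame_ne_zero (hchart p₀) hx₀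
      (right_ne_zero_of_mul (hg.det_frame_mul_det_frame_ne_zero (hchart p₀) hx₀)))

theorem isExact_of_isGloballyCartesian (hα : ∀ e, IsChart e → α ∈ parallelForms e g)
    (hg : g.IsGloballyCartesian) : α.IsExact := by
  obtain ⟨ε, φ, -, hφ, hgφ⟩ := hg
  have hψ : ∀ a, ContMDiff (𝓡 n) 𝓘(ℝ, ℂ) ∞ (Complex.ofRealCLM ∘ φ a) := fun a =>
    Complex.ofRealCLM.contMDiff.comp (hφ a)
  have hdψ : ∀ a p (v : TangentSpace (𝓡 n) p),
      OneForm.differential n (Complex.ofRealCLM ∘ φ a) p v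
        = ((show ℝ from mfderiv (𝓡 n) 𝓘(ℝ, ℝ) (φ a) p v : ℝ) : ℂ) := by
    intro a p v
    rw [OneForm.differential, mfderiv_comp p Complex.ofRealCLM.mdifferentiableAt
      ((hφ a).mdifferentiableAt (by simp)), ContinuousLinearMap.mfderiv_eq]
    rfl
  have hdiag : g.IsDiagonalizedBy (fun a => (ε a : ℂ))
      fun a => OneForm.differential n (Complex.ofRealCLM ∘ φ a) := by
    intro p v w
    rw [hgφ p v w, Complex.ofReal_sum]
    refine Finset.sum_congr rfl fun a _ => ?_
    rw [hdψ, hdψ, Complex.ofReal_mul, Complex.ofReal_mul, mul_assoc]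
  exact hdiag.isExact_of_mem_parallelForms (fun a => OneForm.isExact_differential (hψ a)) hα

end Cartesian

section NullConnection

variable {n : ℕ} {M : Type*} [TopologicalSpace M] [ChartedSpace (Model n) M]
  {g : Metric n M} {α : OneForm n M} {e : OpenPartialHomeomorph M (Model n)} {x : Model n}
  {y : M → Model n}

theorem IsGlobalCoordinates.contMDiff (hy : IsGlobalCoordinates y) :
    ContMDiff (𝓡 n) 𝓘(ℝ, Model n) ∞ y := by
  intro p
  obtain ⟨e, he, hp, hye⟩ := hy p
  exact (contMDiffAt_of_mem_maximalAtlas he hp).congr_of_eventuallyEq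
    (Filter.eventually_of_mem (e.open_source.mem_nhds hp) hye)

/-- The `a`-th real coordinate as a complex-valued covector of the model space. -/
def coordCovector (a : Fin n) : Model n →L[ℝ] ℂ := Complex.ofRealCLM.comp (EuclideanSpace.proj a)

/-- The coordinate differential `dy^a`, as a complex-valued 1-form. -/
def coordForm (y : M → Model n) (a : Fin n) : OneForm n M :=
  OneForm.differential n (coordCovector a ∘ y)

namespace IsGlobalCoordinates

theorem contMDiff_coord (hy : IsGlobalCoordinates y) (a : Fin n) :
    ContMDiff (𝓡 n) 𝓘(ℝ, ℂ) ∞ (coordCovector a ∘ y) :=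
  (coordCovector a).contMDiff.comp hy.contMDiff

theorem inChart_coordForm (hy : IsGlobalCoordinates y) (he : IsChart e)
    (hye : Set.EqOn y e e.source) (hx : x ∈ e.target) (a : Fin n) :
    (coordForm y a).inChart e x = coordCovector a := by
  have heq : (coordCovector a ∘ y) ∘ e.symm =ᶠ[nhds x] coordCovector a :=
    Filter.eventually_of_mem (e.open_target.mem_nhds hx) fun z hz => by
      simp only [Function.comp_apply, hye (e.map_target hz), e.right_inv hz]
  rw [coordForm, OneForm.inChart_differential (hy.contMDiff_coord a) he hx, heq.fderiv_eq,
    ContinuousLinearMap.fderiv]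

theorem frame_coordForm (hy : IsGlobalCoordinates y) (he : IsChart e)
    (hye : Set.EqOn y e e.source) (hx : x ∈ e.target) : frame (coordForm y) e x = 1 := by
  ext a b
  change (coordForm y a).inChart e x (stdVec n b) = _
  rw [hy.inChart_coordForm he hye hx]
  simp [coordCovector, stdVec, Matrix.one_apply, apply_ite Complex.ofReal]

theorem coordForm_mem_parallelForms (hy : IsGlobalCoordinates y) (he : IsChart e)
    (hye : Set.EqOn y e e.source) (hnull : g.ConnectionNullIn y) (a : Fin n) :
    coordForm y a ∈ parallelForms e g := by
  refine ⟨OneForm.contDiffOn_inChart_differential (hy.contMDiff_coord a) he, fun x hx u v => ?_⟩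
  have hΓ : g.christoffelMap e x u v = 0 := by
    ext c
    simp [Metric.christoffelMap_apply, hnull e he hye x hx]
  have hconst : (coordForm y a).inChart e =ᶠ[nhds x] fun _ => coordCovector a :=
    Filter.eventually_of_mem (e.open_target.mem_nhds hx) fun z hz =>
      hy.inChart_coordForm he hye hz a
  rw [hΓ, map_zero, hconst.fderiv_eq, fderiv_fun_const]
  rfl

end IsGlobalCoordinates

theorem isExact_of_connectionNullIn [IsManifold (𝓡 n) ∞ M] [ConnectedSpace M]
    (hα : ∀ e, IsChart e → α ∈ parallelForms e g) (hy : IsGlobalCoordinates y)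
    (hnull : g.ConnectionNullIn y) : α.IsExact := by
  obtain ⟨p₀⟩ := (inferInstance : Nonempty M)
  obtain ⟨e₀, he₀, hp₀, hye₀⟩ := hy p₀
  have hx₀ := e₀.map_source hp₀
  refine isExact_of_mem_parallelForms (g := g) (B := coordForm y)
    (fun a => OneForm.isExact_differential (hy.contMDiff_coord a)) (fun p => ?_)
    (apply_mem_span_of_det_frame_ne_zero he₀ hx₀
      (by simp [hy.frame_coordForm he₀ hye₀ hx₀]))
  obtain ⟨e, he, hp, hye⟩ := hy p
  exact ⟨e, he, hp, hα e he, hy.coordForm_mem_parallelForms he hye hnull⟩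

end NullConnection

/-! ### Closed forms on simply connected manifolds -/

section Gluing

variable {X ι F : Type*} [TopologicalSpace X] [AddGroup F]

/-- The bundle over `X` with discrete fibre whose continuous sections are the functions that differ
on each `U i` from `f i` by a locally constant function. Its fibre coordinate over `U i` is the
difference with `f i`. -/
def gluingCore [TopologicalSpace F] [DiscreteTopology F] (U : ι → Set X) (hU : ∀ i, IsOpen (U i))
    (indexAt : X → ι) (hmem : ∀ x, x ∈ U (indexAt x)) (f : ι → X → F)
    (hf : ∀ i j, ∀ x ∈ U i ∩ U j, ∀ᶠ y in nhds x, f i y - f j y = f i x - f j x) :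
    FiberBundleCore ι X F where
  baseSet := U
  isOpen_baseSet := hU
  indexAt := indexAt
  mem_baseSet_at := hmem
  coordChange i j x v := v + (f i x - f j x)
  coordChange_self i x _ v := by simp
  continuousOn_coordChange i j := by
    rintro ⟨x, v⟩ hx
    refine ContinuousAt.continuousWithinAt
      ((continuousAt_const (y := v + (f i x - f j x))).congr ?_)
    rw [nhds_prod_eq, nhds_discrete F, Filter.prod_pure, Filter.EventuallyEq,
      Filter.eventually_map]
    exact (hf i j x hx.1).mono fun y hy => by simp [hy]
  coordChange_comp i j k x _ v := by rw [add_assoc, sub_add_sub_cancel]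

theorem exists_forall_eventually_sub_eq [SimplyConnectedSpace X] [LocallyPathConnectedSpace X]
    {U : ι → Set X} (hU : ∀ i, IsOpen (U i)) (hcover : ∀ x, ∃ i, x ∈ U i) {f : ι → X → F}
    (hf : ∀ i j, ∀ x ∈ U i ∩ U j, ∀ᶠ y in nhds x, f i y - f j y = f i x - f j x) :
    ∃ φ : X → F, ∀ i, ∀ x ∈ U i, ∀ᶠ y in nhds x, φ y - f i y = φ x - f i x := by
  choose indexAt hmem using hcover
  let _ : TopologicalSpace F := ⊥
  have : DiscreteTopology F := ⟨rfl⟩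
  let Z := gluingCore U hU indexAt hmem f hf
  have hcov : IsCoveringMap Z.proj := FiberBundle.isCoveringMap (F := F) (E := Z.Fiber)
  obtain ⟨x₀⟩ := (inferInstance : Nonempty X)
  obtain ⟨s, ⟨-, hs⟩, -⟩ := hcov.existsUnique_continuousMap_lifts (ContinuousMap.id X) x₀
    (⟨x₀, (0 : F)⟩ : Z.TotalSpace) rfl
  have hbase : ∀ y, (s y).1 = y := congrFun hs
  let φ : X → F := fun y => (show F from (s y).2) + f (indexAt (s y).1) (s y).1
  refine ⟨φ, fun i x hx => ?_⟩
  have hcoord : ∀ y, (Z.localTriv i (s y)).2 = φ y - f i y := by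
    intro y
    change (show F from (s y).2) + (f (indexAt (s y).1) (s y).1 - f i (s y).1) = _
    have hfi : f i (s y).1 = f i y := by rw [hbase y]
    rw [hfi, ← add_sub_assoc]
  have hmem : s x ∈ (Z.localTriv i).source := by
    rw [Z.mem_localTriv_source, hbase x]
    exact hx
  have hcont : ContinuousAt (fun y => (Z.localTriv i (s y)).2) x :=
    continuousAt_snd.comp (((Z.localTriv i).toOpenPartialHomeomorph.continuousAt hmem).comp
      s.continuous.continuousAt)
  rw [ContinuousAt, nhds_discrete F, Filter.tendsto_pure] at hcont
  simpa only [hcoord] using hcont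

end Gluing

section Primitive

variable {n : ℕ} {M : Type*} [TopologicalSpace M] [ChartedSpace (Model n) M]
  {e : OpenPartialHomeomorph M (Model n)} {α : OneForm n M}

theorem OneForm.IsClosed.exists_primitive_on_ball (hc : α.IsClosed) (hα : α.IsSmooth)
    (he : IsChart e) {x₀ : Model n} {r : ℝ} (hr : Metric.ball x₀ r ⊆ e.target) :
    ∃ f : Model n → ℂ, ContDiffOn ℝ ∞ f (Metric.ball x₀ r) ∧
      ∀ x ∈ Metric.ball x₀ r, HasFDerivAt f (α.inChart e x) x := by
  have hsmooth := (hα.contDiffOn_inChart he).mono hr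
  obtain ⟨f, hf⟩ := (convex_ball x₀ r).exists_forall_hasFDerivAt_of_fderiv_symmetric
    Metric.isOpen_ball (hsmooth.differentiableOn (by simp))
    fun x hx u v => hc.fderiv_inChart_symm hα he (hr hx) u v
  refine ⟨f, ?_, hf⟩
  rw [contDiffOn_infty_iff_fderiv_of_isOpen Metric.isOpen_ball]
  exact ⟨fun x hx => (hf x hx).differentiableAt.differentiableWithinAt,
    hsmooth.congr fun x hx => (hf x hx).fderiv⟩

variable [IsManifold (𝓡 n) ∞ M]

theorem OneForm.inChart_mfderiv (α : OneForm n M) (he : IsChart e) {p : M} (hp : p ∈ e.source)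
    (v : TangentSpace (𝓡 n) p) : α.inChart e (e p) (mfderiv (𝓡 n) (𝓡 n) e p v) = α p v := by
  have : IsManifold (𝓡 n) 1 M := IsManifold.of_le (n := ∞) (by simp)
  have hcongr : ∀ q, q = p → ∀ w : Model n, (show Model n →L[ℝ] ℂ from α q) w
      = (show Model n →L[ℝ] ℂ from α p) w := by
    rintro q rfl w
    rfl
  exact (hcongr _ (e.left_inv hp) _).trans (congrArg (α p) (congrArg
    (fun L : TangentSpace (𝓡 n) p →L[ℝ] TangentSpace (𝓡 n) p => L v)
    (he.mdifferentiable.symm_comp_deriv hp)))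

theorem OneForm.IsClosed.exists_local_primitive (hc : α.IsClosed) (hα : α.IsSmooth) (p : M) :
    ∃ (U : Set M) (f : M → ℂ), IsOpen U ∧ p ∈ U ∧ ContMDiffOn (𝓡 n) 𝓘(ℝ, ℂ) ∞ f U ∧
      ∀ q ∈ U, HasMFDerivAt (𝓡 n) 𝓘(ℝ, ℂ) f q (α q) := by
  set e := chartAt (Model n) p
  have he : IsChart e := IsManifold.chart_mem_maximalAtlas p
  have hp : p ∈ e.source := mem_chart_source _ p
  obtain ⟨r, hr0, hr⟩ := Metric.isOpen_iff.1 e.open_target (e p) (e.map_source hp)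
  obtain ⟨f, hf, hf'⟩ := hc.exists_primitive_on_ball hα he hr
  refine ⟨e.source ∩ e ⁻¹' Metric.ball (e p) r, f ∘ e, e.isOpen_inter_preimage Metric.isOpen_ball,
    ⟨hp, Metric.mem_ball_self hr0⟩, ?_, fun q hq => ?_⟩
  · exact hf.contMDiffOn.comp ((contMDiffOn_of_mem_maximalAtlas he).mono Set.inter_subset_left)
      fun q hq => hq.2
  · have hpull : ((α.inChart e (e q)).comp (mfderiv (𝓡 n) (𝓡 n) e q) :
        TangentSpace (𝓡 n) q →L[ℝ] ℂ) = α q :=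
      ContinuousLinearMap.ext (α.inChart_mfderiv he hq.1)
    rw [← hpull]
    exact (hf' (e q) hq.2).hasMFDerivAt.comp q
      (he.mdifferentiable.mdifferentiableAt hq.1).hasMFDerivAt

theorem eventually_eq_of_hasMFDerivAt_zero {F : Type*} [NormedAddCommGroup F] [NormedSpace ℝ F]
    {f : M → F} {U : Set M} (hU : IsOpen U)
    (hf : ∀ q ∈ U, HasMFDerivAt (𝓡 n) 𝓘(ℝ, F) f q
      (0 : TangentSpace (𝓡 n) q →L[ℝ] TangentSpace 𝓘(ℝ, F) (f q)))
    {p : M} (hp : p ∈ U) : ∀ᶠ q in nhds p, f q = f p := by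
  set e := chartAt (Model n) p
  have he : IsChart e := IsManifold.chart_mem_maximalAtlas p
  have hpe : p ∈ e.source := mem_chart_source _ p
  set V := e.target ∩ e.symm ⁻¹' U
  have hV : IsOpen V := e.isOpen_inter_preimage_symm hU
  have hd : ∀ x ∈ V, HasFDerivAt (f ∘ e.symm) (0 : Model n →L[ℝ] F) x := fun x hx => by
    simpa using! ((hf _ hx.2).comp x
      (he.mdifferentiable.mdifferentiableAt_symm hx.1).hasMFDerivAt).hasFDerivAt
  have hlevel : IsOpen (V ∩ f ∘ e.symm ⁻¹' {f p}) := hV.isOpen_inter_preimage_of_fderiv_eq_zero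
    (fun x hx => (hd x hx).differentiableAt.differentiableWithinAt) (fun x hx => (hd x hx).fderiv) _
  have hmem : e p ∈ V ∩ (f ∘ e.symm) ⁻¹' {f p} := by
    refine ⟨⟨e.map_source hpe, ?_⟩, ?_⟩ <;> simp [e.left_inv hpe, hp]
  filter_upwards [(e.continuousAt hpe).preimage_mem_nhds (hlevel.mem_nhds hmem),
    e.open_source.mem_nhds hpe] with q hq hqe
  simpa [e.left_inv hqe] using hq.2

theorem OneForm.IsClosed.isExact [SimplyConnectedSpace M] (hc : α.IsClosed) (hα : α.IsSmooth) :
    α.IsExact := by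
  have : LocallyPathConnectedSpace M := ChartedSpace.locallyPathConnectedSpace (Model n) M
  choose U f hU hmem hf hf' using hc.exists_local_primitive hα
  have hconst : ∀ i j, ∀ x ∈ U i ∩ U j, ∀ᶠ y in nhds x, f i y - f j y = f i x - f j x := by
    intro i j x hx
    refine eventually_eq_of_hasMFDerivAt_zero (n := n) (f := fun y => f i y - f j y)
      ((hU i).inter (hU j)) (fun q hq => ?_) hx
    have h := (hf' i q hq.1).sub (hf' j q hq.2)
    rwa [sub_self (α q)] at h
  obtain ⟨φ, hφ⟩ := exists_forall_eventually_sub_eq hU (fun p => ⟨p, hmem p⟩) hconst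
  have heq : ∀ p, φ =ᶠ[nhds p] fun y => f p y + (φ p - f p p) := fun p =>
    (hφ p p (hmem p)).mono fun y hy => sub_eq_iff_eq_add'.1 hy
  refine ⟨φ, fun p => ?_, fun p v => ?_⟩
  · exact (((hf p).contMDiffAt ((hU p).mem_nhds (hmem p))).add
      contMDiffAt_const).congr_of_eventuallyEq (heq p)
  · rw [(((hf' p p (hmem p)).add
      (hasMFDerivAt_const (φ p - f p p) p)).congr_of_eventuallyEq (heq p)).mfderiv]
    exact congrArg (fun L : TangentSpace (𝓡 n) p →L[ℝ] ℂ => L v) (add_zero (α p)).symm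

end Primitive

/-! ### Geodesics -/

section Acceleration

variable {n : ℕ} {M : Type*} [TopologicalSpace M] [ChartedSpace (Model n) M]
  {e : OpenPartialHomeomorph M (Model n)} {g : Metric n M} {α : OneForm n M}

theorem hasDerivAt_inChart_apply_of_mem_parallelForms (hα : α ∈ parallelForms e g)
    {x v : ℝ → Model n} {x' v' : Model n} {s : ℝ} (hs : x s ∈ e.target)
    (hx : HasDerivAt x x' s) (hv : HasDerivAt v v' s) :
    HasDerivAt (fun t => α.inChart e (x t) (v t))
      (α.inChart e (x s) (v' + g.christoffelMap e (x s) x' (v s))) s := by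
  have hd := ((differentiableAt_of_contDiffOn hα.1 e.open_target hs).hasFDerivAt.comp_hasDerivAt
    s hx).clm_apply hv
  rwa [hα.2 (x s) hs, Function.comp_apply, ← map_add, add_comm] at hd

/-- The covariant acceleration of a curve, read in a chart. -/
def Metric.acceleration (g : Metric n M) (e : OpenPartialHomeomorph M (Model n)) (γ : ℝ → M)
    (s : ℝ) : Model n :=
  deriv (deriv (e ∘ γ)) s
    + g.christoffelMap e (e (γ s)) (deriv (e ∘ γ) s) (deriv (e ∘ γ) s)

theorem differentiableAt_deriv_of_contDiffAt {F : Type*} [NormedAddCommGroup F] [NormedSpace ℝ F]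
    {u : ℝ → F} {s : ℝ} (hu : ContDiffAt ℝ ∞ u s) : DifferentiableAt ℝ (deriv u) s :=
  ((hu.fderiv_right (m := ∞) (by simp)).clm_apply contDiffAt_const).differentiableAt (by simp)

theorem deriv_coord {u : ℝ → Model n} {s : ℝ} (hu : DifferentiableAt ℝ u s) (c : Fin n) :
    deriv (fun t => u t c) s = deriv u s c :=
  ((EuclideanSpace.proj (𝕜 := ℝ) c).hasFDerivAt.comp_hasDerivAt s hu.hasDerivAt).deriv

theorem Metric.acceleration_coord {γ : ℝ → M} {s : ℝ} (hγ : ContDiffAt ℝ ∞ (e ∘ γ) s)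
    (c : Fin n) :
    g.acceleration e γ s c = deriv (deriv fun t => e (γ t) c) s
      + ∑ a, ∑ b, g.christoffel e c a b (e (γ s))
          * deriv (fun t => e (γ t) a) s * deriv (fun t => e (γ t) b) s := by
  have hvel : ∀ᶠ t in nhds s, ∀ a, deriv (fun t => e (γ t) a) t = deriv (e ∘ γ) t a := by
    filter_upwards [(hγ.of_le (m := 1) (by simp)).eventually (by simp)] with t ht
    exact deriv_coord (u := e ∘ γ) (ht.differentiableAt one_ne_zero)
  have hacc : deriv (deriv fun t => e (γ t) c) s = deriv (deriv (e ∘ γ)) s c := by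
    have hc : (deriv fun t => e (γ t) c) =ᶠ[nhds s] fun t => deriv (e ∘ γ) t c :=
      hvel.mono fun t ht => ht c
    rw [hc.deriv_eq, deriv_coord (differentiableAt_deriv_of_contDiffAt hγ)]
  rw [acceleration, PiLp.add_apply, christoffelMap_apply, hacc]
  simp only [hvel.self_of_nhds]

theorem contDiffAt_chart_comp (he : IsChart e) {γ : ℝ → M} {s : ℝ}
    (hγ : ContMDiffAt 𝓘(ℝ, ℝ) (𝓡 n) ∞ γ s) (hs : γ s ∈ e.source) :
    ContDiffAt ℝ ∞ (e ∘ γ) s :=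
  ((contMDiffAt_of_mem_maximalAtlas he hs).comp s hγ).contDiffAt

theorem OneForm.apply_mfderiv_curve [IsManifold (𝓡 n) ∞ M] (α : OneForm n M) (he : IsChart e)
    {γ : ℝ → M} {s : ℝ} (hγ : MDifferentiableAt 𝓘(ℝ, ℝ) (𝓡 n) γ s) (hs : γ s ∈ e.source) :
    α (γ s) (mfderiv 𝓘(ℝ, ℝ) (𝓡 n) γ s (1 : ℝ)) = α.inChart e (e (γ s)) (deriv (e ∘ γ) s) := by
  have hchain := mfderiv_comp s (he.mdifferentiable.mdifferentiableAt hs) hγ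
  rw [mfderiv_eq_fderiv] at hchain
  have hvel : deriv (e ∘ γ) s
      = mfderiv (𝓡 n) (𝓡 n) e (γ s) (mfderiv 𝓘(ℝ, ℝ) (𝓡 n) γ s (1 : ℝ)) := by
    rw [← fderiv_apply_one_eq_deriv]
    exact congrArg (fun L : ℝ →L[ℝ] Model n => L 1) hchain
  rw [hvel]
  exact (α.inChart_mfderiv he hs _).symm

theorem hasDerivAt_apply_mfderiv_curve [IsManifold (𝓡 n) ∞ M] (he : IsChart e)
    (hα : α ∈ parallelForms e g) {γ : ℝ → M} {s : ℝ}
    (hγ : ∀ᶠ t in nhds s, ContMDiffAt 𝓘(ℝ, ℝ) (𝓡 n) ∞ γ t) (hs : γ s ∈ e.source) :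
    HasDerivAt (fun t => α (γ t) (mfderiv 𝓘(ℝ, ℝ) (𝓡 n) γ t (1 : ℝ)))
      (α.inChart e (e (γ s)) (g.acceleration e γ s)) s := by
  have hu := contDiffAt_chart_comp he hγ.self_of_nhds hs
  have hsource : ∀ᶠ t in nhds s, γ t ∈ e.source :=
    hγ.self_of_nhds.continuousAt.preimage_mem_nhds (e.open_source.mem_nhds hs)
  refine (hasDerivAt_inChart_apply_of_mem_parallelForms hα (x := e ∘ γ) (e.map_source hs)
    (hu.differentiableAt (by simp)).hasDerivAt
    (differentiableAt_deriv_of_contDiffAt hu).hasDerivAt).congr_of_eventuallyEq ?_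
  filter_upwards [hγ, hsource] with t ht hts
  exact α.apply_mfderiv_curve he (ht.mdifferentiableAt (by simp)) hts

theorem Metric.isGeodesicOn_iff {γ : ℝ → M} {s₀ s₁ : ℝ} :
    g.IsGeodesicOn γ s₀ s₁ ↔ ContMDiffOn 𝓘(ℝ, ℝ) (𝓡 n) ∞ γ (Set.Ioo s₀ s₁) ∧
      ∀ e : OpenPartialHomeomorph M (Model n), IsChart e →
        ∀ s ∈ Set.Ioo s₀ s₁, γ s ∈ e.source → g.acceleration e γ s = 0 := by
  refine and_congr_right fun hγ => forall₅_congr fun e he s hs hse => ?_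
  have hu := contDiffAt_chart_comp he (hγ.contMDiffAt (isOpen_Ioo.mem_nhds hs)) hse
  rw [PiLp.ext_iff]
  exact forall_congr' fun c => by rw [acceleration_coord hu, PiLp.zero_apply]

theorem Metric.acceleration_eq_christoffelMap_of_straight {γ : ℝ → M} {q v : Model n} {s : ℝ}
    (hγ : ∀ᶠ t in nhds s, e (γ t) = q + t • v) :
    g.acceleration e γ s
      = g.christoffelMap e (e (γ s)) (deriv (e ∘ γ) s) (deriv (e ∘ γ) s) := by
  have hderiv : deriv (fun t : ℝ => q + t • v) = fun _ => v := by
    funext t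
    simpa using! (((hasDerivAt_id t).smul_const v).const_add q).deriv
  have heq : (e ∘ γ) =ᶠ[nhds s] fun t => q + t • v := hγ
  rw [acceleration, heq.deriv.deriv_eq, hderiv, deriv_const, zero_add]

theorem Metric.christoffelMap_eq_zero_of_forall_self {x : Model n}
    (h : ∀ w, g.christoffelMap e x w w = 0) : g.christoffelMap e x = 0 := by
  ext1 u
  ext1 v
  have hpolar := h (u + v)
  rw [map_add, map_add, add_apply, add_apply, h u, h v, g.christoffelMap_symm e x v u, zero_add,
    add_zero, ← two_smul ℝ] at hpolar
  exact (smul_eq_zero.1 hpolar).resolve_left two_ne_zero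

end Acceleration

section Spray

variable {n : ℕ} {M : Type*} [TopologicalSpace M] [ChartedSpace (Model n) M]
  {e : OpenPartialHomeomorph M (Model n)} {g : Metric n M}

/-- The geodesic spray: the vector field on the tangent bundle of a chart whose integral curves are
the geodesics with their velocities. -/
def Metric.spray (g : Metric n M) (e : OpenPartialHomeomorph M (Model n))
    (z : Model n × Model n) : Model n × Model n :=
  (z.2, -g.christoffelMap e z.1 z.2 z.2)

theorem deriv_chart_comp_of_spray {σ : ℝ → Model n × Model n} {s₀ s₁ : ℝ}
    (hσ : ∀ t ∈ Set.Ioo s₀ s₁, σ t ∈ e.target ×ˢ Set.univ ∧ HasDerivAt σ (g.spray e (σ t)) t)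
    {s : ℝ} (hs : s ∈ Set.Ioo s₀ s₁) : deriv (e ∘ fun t => e.symm (σ t).1) s = (σ s).2 := by
  have heq : (e ∘ fun t => e.symm (σ t).1) =ᶠ[nhds s] fun t => (σ t).1 :=
    Filter.eventually_of_mem (isOpen_Ioo.mem_nhds hs) fun t ht => e.right_inv (hσ t ht).1.1
  rw [heq.deriv_eq]
  exact ((ContinuousLinearMap.fst ℝ (Model n) (Model n)).hasFDerivAt.comp_hasDerivAt s
    (hσ s hs).2).deriv

theorem acceleration_eq_zero_of_spray {σ : ℝ → Model n × Model n} {s₀ s₁ : ℝ}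
    (hσ : ∀ t ∈ Set.Ioo s₀ s₁, σ t ∈ e.target ×ˢ Set.univ ∧ HasDerivAt σ (g.spray e (σ t)) t)
    {s : ℝ} (hs : s ∈ Set.Ioo s₀ s₁) : g.acceleration e (fun t => e.symm (σ t).1) s = 0 := by
  have heq : deriv (e ∘ fun t => e.symm (σ t).1) =ᶠ[nhds s] fun t => (σ t).2 :=
    Filter.eventually_of_mem (isOpen_Ioo.mem_nhds hs) fun t ht => deriv_chart_comp_of_spray hσ ht
  have hsnd : deriv (fun t => (σ t).2) s = -g.christoffelMap e (σ s).1 (σ s).2 (σ s).2 :=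
    ((ContinuousLinearMap.snd ℝ (Model n) (Model n)).hasFDerivAt.comp_hasDerivAt s
      (hσ s hs).2).deriv
  rw [Metric.acceleration, heq.deriv_eq, heq.self_of_nhds, e.right_inv (hσ s hs).1.1, hsnd,
    neg_add_cancel]

theorem exists_contDiffOn_hasDerivAt {E : Type*} [NormedAddCommGroup E] [NormedSpace ℝ E]
    [CompleteSpace E] {f : E → E} {U : Set E} (hU : IsOpen U) (hf : ContDiffOn ℝ ∞ f U) {z₀ : E}
    (hz₀ : z₀ ∈ U) (t₀ : ℝ) :
    ∃ σ : ℝ → E, σ t₀ = z₀ ∧ ∃ ε > 0, ContDiffOn ℝ ∞ σ (Set.Ioo (t₀ - ε) (t₀ + ε)) ∧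
      ∀ t ∈ Set.Ioo (t₀ - ε) (t₀ + ε), σ t ∈ U ∧ HasDerivAt σ (f (σ t)) t := by
  obtain ⟨σ, hσ₀, ε, hε, hσ⟩ := ((hf.contDiffAt (hU.mem_nhds hz₀)).of_le
    (by simp)).exists_forall_mem_closedBall_exists_eq_forall_mem_Ioo_hasDerivAt₀ t₀
  have hcont : ContinuousAt σ t₀ := (hσ t₀ (by simp [hε])).continuousAt
  obtain ⟨δ, hδ, hδε⟩ := Metric.nhds_basis_closedBall.mem_iff.1 (Filter.inter_mem
    (hcont.preimage_mem_nhds (hU.mem_nhds (hσ₀ ▸ hz₀)))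
    (Ioo_mem_nhds (sub_lt_self t₀ hε) (lt_add_of_pos_right t₀ hε)))
  rw [Real.closedBall_eq_Icc] at hδε
  refine ⟨σ, hσ₀, δ, hδ, ?_, fun t ht => ?_⟩
  · exact (ODE.contDiffOn_enat_Icc_of_hasDerivWithinAt (n := ⊤) (f := fun _ => f) (u := U)
      (hf.comp contDiffOn_snd fun z hz => hz.2)
      (fun t ht => (hσ t (hδε ht).2).hasDerivWithinAt)
      fun t ht => (hδε ht).1).mono Set.Ioo_subset_Icc_self
  · exact ⟨(hδε (Set.Ioo_subset_Icc_self ht)).1, hσ t (hδε (Set.Ioo_subset_Icc_self ht)).2⟩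

end Spray

section Existence

variable {n : ℕ} {M : Type*} [TopologicalSpace M] [ChartedSpace (Model n) M]
  [IsManifold (𝓡 n) ∞ M] {e : OpenPartialHomeomorph M (Model n)} {g : Metric n M}
  {c : Fin n → ℂ} {A : Fin n → OneForm n M}

theorem Metric.IsDiagonalizedBy.isGeodesicOn_of_acceleration_eq_zero
    (hg : g.IsDiagonalizedBy c A) (hpar : ∀ e, IsChart e → ∀ I, A I ∈ parallelForms e g)
    (he : IsChart e) {γ : ℝ → M} {s₀ s₁ : ℝ}
    (hγ : ContMDiffOn 𝓘(ℝ, ℝ) (𝓡 n) ∞ γ (Set.Ioo s₀ s₁))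
    (hsource : ∀ s ∈ Set.Ioo s₀ s₁, γ s ∈ e.source)
    (hacc : ∀ s ∈ Set.Ioo s₀ s₁, g.acceleration e γ s = 0) : g.IsGeodesicOn γ s₀ s₁ := by
  refine isGeodesicOn_iff.2 ⟨hγ, fun e' he' s hs hse' => ?_⟩
  have hsmooth : ∀ᶠ t in nhds s, ContMDiffAt 𝓘(ℝ, ℝ) (𝓡 n) ∞ γ t :=
    Filter.eventually_of_mem (isOpen_Ioo.mem_nhds hs) fun t ht =>
      hγ.contMDiffAt (isOpen_Ioo.mem_nhds ht)
  have hA : ∀ I, (A I).inChart e' (e' (γ s)) (g.acceleration e' γ s) = 0 := fun I => by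
    rw [(hasDerivAt_apply_mfderiv_curve he' (hpar e' he' I) hsmooth hse').unique
      (hasDerivAt_apply_mfderiv_curve he (hpar e he I) hsmooth (hsource s hs)), hacc s hs, map_zero]
  refine g.inChart_nondegenerate he' (e'.map_source hse') fun w => ?_
  rw [← Complex.ofReal_eq_zero, hg.inChart_apply]
  simp only [hA, zero_mul, mul_zero, Finset.sum_const_zero]

theorem Metric.contDiffOn_spray (he : IsChart e) :
    ContDiffOn ℝ ∞ (g.spray e) (e.target ×ˢ Set.univ) :=
  contDiffOn_snd.prodMk ((((g.contDiffOn_christoffelMap he).comp contDiffOn_fst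
    fun _ hz => hz.1).clm_apply contDiffOn_snd).clm_apply contDiffOn_snd).neg

theorem Metric.IsDiagonalizedBy.exists_isGeodesicOn (hg : g.IsDiagonalizedBy c A)
    (hpar : ∀ e, IsChart e → ∀ I, A I ∈ parallelForms e g) (he : IsChart e) {x : Model n}
    (hx : x ∈ e.target) (w : Model n) :
    ∃ δ > 0, ∃ γ : ℝ → M, g.IsGeodesicOn γ (-δ) δ ∧ (∀ t ∈ Set.Ioo (-δ) δ, γ t ∈ e.source) ∧
      e (γ 0) = x ∧ deriv (e ∘ γ) 0 = w := by
  obtain ⟨σ, hσ₀, δ, hδ, hsmooth, hσ⟩ := exists_contDiffOn_hasDerivAt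
    (e.open_target.prod isOpen_univ) (g.contDiffOn_spray he) (z₀ := (x, w)) ⟨hx, trivial⟩ 0
  rw [zero_sub, zero_add] at hsmooth hσ
  have hsource : ∀ t ∈ Set.Ioo (-δ) δ, e.symm (σ t).1 ∈ e.source := fun t ht =>
    e.map_target (hσ t ht).1.1
  have hγ : ContMDiffOn 𝓘(ℝ, ℝ) (𝓡 n) ∞ (fun t => e.symm (σ t).1) (Set.Ioo (-δ) δ) :=
    (contMDiffOn_symm_of_mem_maximalAtlas he).comp
      (contDiff_fst.comp_contDiffOn hsmooth).contMDiffOn fun t ht => (hσ t ht).1.1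
  refine ⟨δ, hδ, fun t => e.symm (σ t).1, hg.isGeodesicOn_of_acceleration_eq_zero hpar he hγ
    hsource fun s hs => acceleration_eq_zero_of_spray hσ hs, hsource, ?_, ?_⟩
  · change e (e.symm (σ 0).1) = x
    rw [hσ₀, e.right_inv hx]
  · rw [deriv_chart_comp_of_spray hσ (by simp [hδ]), hσ₀]

theorem Metric.IsDiagonalizedBy.connectionNullIn_of_geodesicsStraightIn
    (hg : g.IsDiagonalizedBy c A) (hpar : ∀ e, IsChart e → ∀ I, A I ∈ parallelForms e g)
    {y : M → Model n} (hy : g.GeodesicsStraightIn y) : g.ConnectionNullIn y := by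
  intro e he hye x hx k a b
  suffices hΓ : g.christoffelMap e x = 0 by
    rw [← christoffelMap_stdVec, hΓ]
    rfl
  refine christoffelMap_eq_zero_of_forall_self fun w => ?_
  obtain ⟨δ, hδ, γ, hγ, hsource, rfl, rfl⟩ := hg.exists_isGeodesicOn hpar he hx w
  obtain ⟨q, v, hline⟩ := hy (-δ) δ γ (by linarith) hγ
  have h0 : (0 : ℝ) ∈ Set.Ioo (-δ) δ := by simp [hδ]
  rw [← acceleration_eq_christoffelMap_of_straight (q := q) (v := v)
    (Filter.eventually_of_mem (isOpen_Ioo.mem_nhds h0) fun t ht => by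
      rw [← hye (hsource t ht), hline t ht])]
  exact (isGeodesicOn_iff.1 hγ).2 e he 0 h0 (hsource 0 h0)

end Existence

end Takagi

end

theorem mainTheorem4_general {n : ℕ} {M : Type*} [TopologicalSpace M] [ConnectedSpace M]
    [ChartedSpace (EuclideanSpace ℝ (Fin n)) M] [IsManifold (𝓡 n) ∞ M]
    (g : Takagi.Metric n M) (c : Fin n → ℂ) (A : Fin n → Takagi.OneForm n M)
    (hg : g.IsDiagonalizedBy c A) (hsmooth : ∀ I, (A I).IsSmooth)
    (hclosed : ∀ I, (A I).IsClosed) (hnonexact : ¬ ∀ I, (A I).IsExact) :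
    ¬ SimplyConnectedSpace M ∧
    g.IsNonCurved ∧
    ¬ g.IsGloballyCartesian ∧
    (∀ y : M → EuclideanSpace ℝ (Fin n), Takagi.IsGlobalCoordinates y →
      ¬ g.ConnectionNullIn y) ∧
    (∀ y : M → EuclideanSpace ℝ (Fin n), Takagi.IsGlobalCoordinates y →
      ¬ g.GeodesicsStraightIn y) := by
  have hpar : ∀ e, Takagi.IsChart e → ∀ I, A I ∈ Takagi.parallelForms e g := fun e he =>
    hg.mem_parallelForms he hsmooth hclosed
  have hnull : ∀ y : M → EuclideanSpace ℝ (Fin n), Takagi.IsGlobalCoordinates y →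
      ¬ g.ConnectionNullIn y := fun y hy hΓ =>
    hnonexact fun I => Takagi.isExact_of_connectionNullIn (fun e he => hpar e he I) hy hΓ
  refine ⟨fun _ => ?_, hg.isNonCurved hpar, fun hcart => ?_, hnull, fun y hy hstraight => ?_⟩
  · exact hnonexact fun I => (hclosed I).isExact (hsmooth I)
  · exact hnonexact fun I => Takagi.isExact_of_isGloballyCartesian (fun e he => hpar e he I) hcart
  · exact hnull y hy (hg.connectionNullIn_of_geodesicsStraightIn hpar hstraight)

theorem mainTheorem4 {n : ℕ} {M : Type*} [TopologicalSpace M] [T2Space M]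
    [SecondCountableTopology M] [ConnectedSpace M]
    [ChartedSpace (EuclideanSpace ℝ (Fin n)) M] [IsManifold (𝓡 n) ∞ M]
    (g : Takagi.Metric n M) (A : Fin n → Takagi.OneForm n M)
    (hA : g.IsTakagiFactorization A)
    (hclosed : ∀ I, (A I).IsClosed) (hnonexact : ¬ ∀ I, (A I).IsExact) :
    ¬ SimplyConnectedSpace M ∧
    g.IsNonCurved ∧
    ¬ g.IsGloballyCartesian ∧
    (∀ y : M → EuclideanSpace ℝ (Fin n), Takagi.IsGlobalCoordinates y →
      ¬ g.ConnectionNullIn y) ∧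
    (∀ y : M → EuclideanSpace ℝ (Fin n), Takagi.IsGlobalCoordinates y →
      ¬ g.GeodesicsStraightIn y) :=
  mainTheorem4_general g (fun _ => 1) A (fun p v w => by simpa using hA.factor p v w) hA.smooth
    hclosed hnonexact
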